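/- Throughout, $\log$ is the binary logarithm, and for a set $A\subseteq\{0,1\}^*$ of binary strings put $A_n=A\cap\{0,1\}^n$. For functions $k=k(n)\in\mathbb N$ and $\beta=\beta(n)>0$, the set $A$ is called \emph{$(k,\beta)$-wise independent} if for all sufficiently large $n$ the set $A_n$ is nonempty and, for every $S\subseteq\{1,\dots,n\}$ with $|S|\le k(n)$ and every $\mathbf c\in\{0,1\}^n$, $$\left|\frac{|\{\mathbf a\in A_n : a_i=c_i \text{ for all } i\in S\}|}{|A_n|}-\frac1{2^{|S|}}\right|\le\beta(n).$$ The set $A$ is called \emph{$\varepsilon$-rich} if for all sufficiently large $n$ the following holds: for every $I\subseteq\{1,\dots,n\}$, every partition $\{R_1,\dots,R_r\}$ of $I$ ($r\ge 0$) with $\prod_{j=1}^r\bigl(1-2^{-|R_j|}\bigr)\ge\varepsilon$, every $Q\subseteq\{1,\dots,n\}\setminus I$ with $|Q|\le\log n$, and every $\mathbf c\in\{0,1\}^n$, there is $\mathbf a\in A_n$ such that $a_i=c_i$ for all $i\in Q$, and for every $j\in\{1,\dots,r\}$ there is $i\in R_j$ with $a_i\ne c_i$. A \emph{read-once conjunction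 of a DNF and a CNF} in $n$ variables is a formula $$\Bigl(\bigvee_{j=1}^q\bigwedge_{i\in Q_j}\ell(x_i)\Bigr)\wedge\bigwedge_{j=1}^r\bigvee_{i\in R_j}\lnot\ell(x_i)$$ with $q,r\ge 0$, pairwise disjoint sets $Q_1,\dots,Q_q,R_1,\dots,R_r\subseteq\{1,\dots,n\}$, and $\ell(x_i)\in\{x_i,\lnot x_i\}$ for each $i$; for $q=0$ the DNF is absent and the formula is the CNF alone. The set $A$ is an \emph{$\varepsilon$-hitting set} for such formulas if for all sufficiently large $n$, every such formula in $n$ variables that is satisfied by at least $\varepsilon 2^n$ of the inputs in $\{0,1\}^n$ is satisfied by some $\mathbf a\in A_n$. \textbf{Theorem.} Let $\varepsilon>0$, let $C$ be the least odd integer greater than $\bigl(\frac2\varepsilon\ln\frac1\varepsilon\bigr)^2$, and let $\beta=\beta(n)$ satisfy $0<\beta(n)<\frac1{n^{C+3}}$ for all sufficiently large $n$. Then every $(\lceil(C+2)\log n\rceil,\beta)$-wise independent set $A\subseteq\{0,1\}^*$ is $\varepsilon$-rich. Consequently, every such set is an $\varepsilon$-hitting set for read-once conjunctions of a DNF and a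 CNF. -/

import Mathlib

open Filter

namespace Richness

/-- `𝒜ₙ = 𝒜 ∩ {0,1}ⁿ`, the strings of length `n` of a set `𝒜 ⊆ {0,1}*`, read as functions
on the bit positions. -/
def slice (A : Set (List Bool)) (n : ℕ) : Set (Fin n → Bool) :=
  {a | List.ofFn a ∈ A}

/-- `𝒜ₙ^S(c)`: the strings of `𝒜ₙ` that coincide with `c` on the positions in `S`. -/
def agreeing (A : Set (List Bool)) {n : ℕ} (S : Finset (Fin n)) (c : Fin n → Bool) :
    Set (Fin n → Bool) :=
  {a ∈ slice A n | ∀ i ∈ S, a i = c i}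

/-- `A` is `(k, β)`-wise independent, where `k` and `β` may depend on the length `n`:
for all sufficiently large `n`, a uniformly random element of `𝒜ₙ` (which is nonempty) has on every
set `S` of at most `k` positions a distribution that is pointwise `β`-close to uniform. -/
def IsAlmostWiseIndependent (k : ℕ → ℕ) (β : ℕ → ℝ) (A : Set (List Bool)) : Prop :=
  ∀ᶠ n : ℕ in atTop, (slice A n).Nonempty ∧
    ∀ S : Finset (Fin n), S.card ≤ k n → ∀ c : Fin n → Bool,
      |((agreeing A S c).ncard : ℝ) / ((slice A n).ncard : ℝ) - 1 / 2 ^ S.card| ≤ β n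

/-- `A` is `ε`-rich. -/
def IsRich (ε : ℝ) (A : Set (List Bool)) : Prop :=
  ∀ᶠ n : ℕ in atTop, ∀ (I : Finset (Fin n)) (P : Finpartition I),
    ε ≤ ∏ R ∈ P.parts, (1 - 1 / (2 : ℝ) ^ R.card) →
    ∀ Q : Finset (Fin n), Disjoint Q I → (Q.card : ℝ) ≤ Real.logb 2 n →
    ∀ c : Fin n → Bool, ∃ a ∈ slice A n,
      (∀ i ∈ Q, a i = c i) ∧ ∀ R ∈ P.parts, ∃ i ∈ R, a i ≠ c i

/-- A read-once conjunction of a DNF and a CNF in the variables `x₁, …, xₙ`,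
`(⋁ⱼ ⋀_{i ∈ Qⱼ} ℓ(xᵢ)) ∧ ⋀ⱼ ⋁_{i ∈ Rⱼ} ¬ ℓ(xᵢ)`,
where `ℓ(xᵢ)` is `xᵢ` if `cᵢ = 1` and `¬ xᵢ` if `cᵢ = 0`. No variable occurs in two of the
sets `Qⱼ`, `Rⱼ`, so the choice of `c` gives every occurring variable an arbitrary sign. -/
structure ReadOnceDNFCNF (n : ℕ) where
  /-- number of terms of the DNF -/
  q : ℕ
  /-- number of clauses of the CNF -/
  r : ℕ
  /-- variables of the terms -/
  Q : Fin q → Finset (Fin n)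
  /-- variables of the clauses -/
  R : Fin r → Finset (Fin n)
  /-- signs of the literals -/
  c : Fin n → Bool
  disjoint_QQ : ∀ j j', j ≠ j' → Disjoint (Q j) (Q j')
  disjoint_RR : ∀ j j', j ≠ j' → Disjoint (R j) (R j')
  disjoint_QR : ∀ j j', Disjoint (Q j) (R j')

/-- The formula is true under the assignment `a`. For `q = 0` the DNF is absent, and the formula
is just the CNF. -/
def ReadOnceDNFCNF.Accepts {n : ℕ} (F : ReadOnceDNFCNF n) (a : Fin n → Bool) : Prop :=
  (F.q = 0 ∨ ∃ j, ∀ i ∈ F.Q j, a i = F.c i) ∧ ∀ j, ∃ i ∈ F.R j, a i ≠ F.c i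

/-- `A` is an `ε`-hitting set for read-once conjunctions of a DNF and a CNF: for all sufficiently
large `n`, every such formula in `n` variables that accepts at least an `ε` fraction of all inputs
accepts some element of `𝒜ₙ`. -/
def IsHittingSetForReadOnceDNFCNF (ε : ℝ) (A : Set (List Bool)) : Prop :=
  ∀ᶠ n : ℕ in atTop, ∀ F : ReadOnceDNFCNF n,
    ε ≤ ({a | F.Accepts a}.ncard : ℝ) / 2 ^ n → ∃ a ∈ slice A n, F.Accepts a

end Richness

namespace Richness

open scoped BigOperators

/-! Let `l = ⌊log n⌋`, and average over `a ∈ Aₙ`. Only bounded-size sets of positions are under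
control, so clauses of size at most `l` and longer ones are treated separately. For short clauses,
`∏ (1 - indicator)` is bounded below by its expansion up to degree `C` (Bonferroni, `C` odd). Each
monomial, together with `Q`, involves at most `(C + 1) l` positions, so its mean is almost the
uniform one. With `p_R = 2^{-|R|}`, the uniform value is at least `ε` minus the elementary symmetric
sum of degree `C + 1`. Since `∑ p_R ≤ ln (1/ε)`, this sum is at most `ln (1/ε)^(C+1) / (C+1)!`,
which is below `ε` by the choice of `C` (`log_pow_lt_mul_factorial`). There are at most `n / (l +
1)` long clauses, each violated with probability below about `1/n`; a union bound costs `1/(l + 1) →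
0` (`exists_agree_and_disagree`, `exists_of_finpartition`).

For hitting sets, an accepted fraction of `ε` bounds the CNF and the DNF separately. The first gives
the product condition of richness, the second a term with at most `log n` literals, which serves as
`Q`. -/

/-! ### Bonferroni inequalities and elementary symmetric sums -/

/-- The sum of the first `k` terms of the expansion of `∏ i ∈ s, (1 - p i)` by degree. -/
noncomputable def truncatedProd {ι : Type*} (k : ℕ) (s : Finset ι) (p : ι → ℝ) : ℝ :=
  ∑ m ∈ Finset.range k, (-1) ^ m * ∑ J ∈ s.powersetCard m, ∏ i ∈ J, p i

lemma sum_powersetCard_succ_insert {ι : Type*} [DecidableEq ι] {s : Finset ι} {x : ι}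
    (hx : x ∉ s) (p : ι → ℝ) (m : ℕ) :
    ∑ J ∈ (insert x s).powersetCard (m + 1), ∏ i ∈ J, p i =
      (∑ J ∈ s.powersetCard (m + 1), ∏ i ∈ J, p i) +
        p x * ∑ J ∈ s.powersetCard m, ∏ i ∈ J, p i := by
  have hmem : ∀ J ∈ s.powersetCard m, x ∉ J := fun J hJ hxJ =>
    hx ((Finset.mem_powersetCard.1 hJ).1 hxJ)
  rw [Finset.powersetCard_succ_insert hx, Finset.sum_union, Finset.sum_image, Finset.mul_sum]
  · congr 1
    exact Finset.sum_congr rfl fun J hJ => Finset.prod_insert (hmem J hJ)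
  · intro J hJ K hK h
    rw [← Finset.erase_insert (hmem J hJ), ← Finset.erase_insert (hmem K hK), h]
  · rw [Finset.disjoint_left]
    intro J hJ hJ'
    obtain ⟨K, -, rfl⟩ := Finset.mem_image.1 hJ'
    exact hx ((Finset.mem_powersetCard.1 hJ).1 (Finset.mem_insert_self _ _))

lemma truncatedProd_succ_insert {ι : Type*} [DecidableEq ι] {s : Finset ι} {x : ι}
    (hx : x ∉ s) (p : ι → ℝ) (k : ℕ) :
    truncatedProd (k + 1) (insert x s) p =
      truncatedProd (k + 1) s p - p x * truncatedProd k s p := by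
  simp only [truncatedProd, Finset.sum_range_succ' _ k, sum_powersetCard_succ_insert hx,
    Finset.powersetCard_zero, Finset.mul_sum (Finset.range k)]
  rw [add_sub_right_comm, ← Finset.sum_sub_distrib]
  congr 1
  exact Finset.sum_congr rfl fun m _ => by ring

/-- The Bonferroni inequalities. -/
lemma neg_one_pow_mul_prod_sub_truncatedProd_nonneg {ι : Type*} (s : Finset ι) (p : ι → ℝ)
    (h0 : ∀ i ∈ s, 0 ≤ p i) (h1 : ∀ i ∈ s, p i ≤ 1) (k : ℕ) :
    0 ≤ (-1) ^ k * (∏ i ∈ s, (1 - p i) - truncatedProd k s p) := by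
  classical
  induction s using Finset.induction_on generalizing k with
  | empty =>
    cases k with
    | zero => simp [truncatedProd]
    | succ k =>
      have : truncatedProd (k + 1) (∅ : Finset ι) p = 1 := by
        rw [truncatedProd, Finset.sum_range_succ', Finset.sum_eq_zero]
        · simp
        · intro m _
          rw [Finset.powersetCard_eq_empty.2 (by simp)]
          simp
      simp [this]
  | insert x s hx ih =>
    have h0' : ∀ i ∈ s, 0 ≤ p i := fun i hi => h0 i (Finset.mem_insert_of_mem hi)
    have h1' : ∀ i ∈ s, p i ≤ 1 := fun i hi => h1 i (Finset.mem_insert_of_mem hi)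
    cases k with
    | zero =>
      simp only [truncatedProd, Finset.range_zero, Finset.sum_empty, pow_zero, one_mul, sub_zero]
      exact Finset.prod_nonneg fun i hi => sub_nonneg.2 (h1 i hi)
    | succ k =>
      -- The error at `k + 1` for `insert x s` is the error at `k + 1` for `s` minus `p x` times the
      -- error at `k` for `s`; the alternating sign makes both contributions nonnegative.
      have hp := mul_nonneg (h0 x (Finset.mem_insert_self _ _)) (ih h0' h1' k)
      have hk := ih h0' h1' (k + 1)
      rw [Finset.prod_insert hx, truncatedProd_succ_insert hx]
      rw [pow_succ] at hk ⊢
      linarith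

lemma truncatedProd_le_prod {ι : Type*} (s : Finset ι) (p : ι → ℝ)
    (h0 : ∀ i ∈ s, 0 ≤ p i) (h1 : ∀ i ∈ s, p i ≤ 1) {k : ℕ} (hk : Even k) :
    truncatedProd k s p ≤ ∏ i ∈ s, (1 - p i) := by
  have := neg_one_pow_mul_prod_sub_truncatedProd_nonneg s p h0 h1 k
  rw [hk.neg_one_pow] at this
  linarith

lemma prod_le_truncatedProd_add {ι : Type*} (s : Finset ι) (p : ι → ℝ)
    (h0 : ∀ i ∈ s, 0 ≤ p i) (h1 : ∀ i ∈ s, p i ≤ 1) {k : ℕ} (hk : Even k) :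
    ∏ i ∈ s, (1 - p i) ≤
      truncatedProd k s p + ∑ J ∈ s.powersetCard k, ∏ i ∈ J, p i := by
  have := neg_one_pow_mul_prod_sub_truncatedProd_nonneg s p h0 h1 (k + 1)
  rw [hk.add_one.neg_one_pow, truncatedProd, Finset.sum_range_succ, hk.neg_one_pow] at this
  rw [truncatedProd]
  linarith

/-- The elementary symmetric functions are bounded by divided powers of the sum. -/
lemma factorial_mul_sum_powersetCard_le {ι : Type*} (s : Finset ι) (p : ι → ℝ)
    (h0 : ∀ i ∈ s, 0 ≤ p i) (m : ℕ) :
    (m.factorial : ℝ) * ∑ J ∈ s.powersetCard m, ∏ i ∈ J, p i ≤ (∑ i ∈ s, p i) ^ m := by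
  classical
  induction s using Finset.induction_on generalizing m with
  | empty =>
    cases m with
    | zero => simp
    | succ m => rw [Finset.powersetCard_eq_empty.2 (by simp)]; simp
  | insert x s hx ih =>
    have h0' : ∀ i ∈ s, 0 ≤ p i := fun i hi => h0 i (Finset.mem_insert_of_mem hi)
    cases m with
    | zero => simp
    | succ m =>
      have hpx := h0 x (Finset.mem_insert_self _ _)
      have hs : 0 ≤ ∑ i ∈ s, p i := Finset.sum_nonneg h0'
      -- Two terms of the binomial expansion.
      have hbin : ∀ (u v : ℝ), 0 ≤ u → 0 ≤ v → ∀ m : ℕ,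
          v ^ (m + 1) + ((m : ℝ) + 1) * (u * v ^ m) ≤ (u + v) ^ (m + 1) := by
        intro u v hu hv m
        induction m with
        | zero => simp [add_comm]
        | succ m ihm =>
          rw [pow_succ (u + v)]
          refine le_trans ?_ (mul_le_mul_of_nonneg_right ihm (add_nonneg hu hv))
          have : 0 ≤ ((m : ℝ) + 1) * (u * u * v ^ m) := by positivity
          push_cast
          have e : (v ^ (m + 1) + ((m : ℝ) + 1) * (u * v ^ m)) * (u + v) =
            v ^ (m + 1 + 1) + ((m : ℝ) + 1 + 1) * (u * v ^ (m + 1)) +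
              ((m : ℝ) + 1) * (u * u * v ^ m) := by ring
          linarith
      rw [sum_powersetCard_succ_insert hx, Finset.sum_insert hx]
      refine le_trans ?_ (hbin _ _ hpx hs m)
      have h1 := ih h0' (m + 1)
      have h2 := mul_le_mul_of_nonneg_left (ih h0' m)
        (mul_nonneg (by positivity : (0 : ℝ) ≤ (m : ℝ) + 1) hpx)
      have e : ((m + 1).factorial : ℝ) = ((m : ℝ) + 1) * m.factorial := by
        rw [Nat.factorial_succ]; push_cast; ring
      rw [mul_add]
      refine add_le_add h1 ?_
      rw [e]
      linarith

/-! ### The choice of `C` -/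

lemma sum_le_log_one_div_of_le_prod {ι : Type*} (s : Finset ι) (p : ι → ℝ) {ε : ℝ} (hε : 0 < ε)
    (h1 : ∀ i ∈ s, p i ≤ 1) (h : ε ≤ ∏ i ∈ s, (1 - p i)) :
    ∑ i ∈ s, p i ≤ Real.log (1 / ε) := by
  have h2 : ∏ i ∈ s, (1 - p i) ≤ Real.exp (-∑ i ∈ s, p i) := by
    rw [← Finset.sum_neg_distrib, Real.exp_sum]
    exact Finset.prod_le_prod (fun i hi => sub_nonneg.2 (h1 i hi))
      fun i _ => Real.one_sub_le_exp_neg (p i)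
  have h3 := Real.log_le_log hε (h.trans h2)
  rw [Real.log_exp] at h3
  rw [one_div, Real.log_inv]
  linarith

/-- With `C = 2m + 1` and `L = ln (1/ε)`, the hypothesis gives `L² < ε² (m + 1)`; the power `m + 1`
of this is compared with `(m + 1)^(m + 1) ≤ (2m + 2)!`. -/
lemma log_pow_lt_mul_factorial {ε : ℝ} (hε : 0 < ε) (hε1 : ε ≤ 1) {C : ℕ} (hodd : Odd C)
    (hC : (2 / ε * Real.log (1 / ε)) ^ 2 < C) :
    Real.log (1 / ε) ^ (C + 1) < ε * (C + 1).factorial := by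
  obtain ⟨m, rfl⟩ := hodd
  set L := Real.log (1 / ε)
  have hL2 : L ^ 2 < ε ^ 2 * ((m : ℝ) + 1) := by
    have e : (2 / ε * L) ^ 2 = 4 * L ^ 2 / ε ^ 2 := by field_simp; ring
    rw [e, div_lt_iff₀ (by positivity)] at hC
    push_cast at hC
    have := mul_pos hε hε
    have := mul_nonneg this.le (Nat.cast_nonneg (α := ℝ) m)
    nlinarith
  have hfac : ((m : ℝ) + 1) ^ (m + 1) ≤ ((2 * m + 1 + 1).factorial : ℝ) := by
    have h := Nat.factorial_mul_pow_le_factorial (m := m + 1) (n := m + 1)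
    have h' : (m + 1) ^ (m + 1) ≤ (2 * m + 1 + 1).factorial := by
      calc (m + 1) ^ (m + 1) ≤ (m + 1 + 1) ^ (m + 1) := by gcongr; omega
        _ ≤ (m + 1).factorial * (m + 1 + 1) ^ (m + 1) :=
          Nat.le_mul_of_pos_left _ (Nat.factorial_pos _)
        _ ≤ _ := by
          refine h.trans (le_of_eq ?_)
          congr 1; omega
    exact_mod_cast h'
  calc L ^ (2 * m + 1 + 1) = (L ^ 2) ^ (m + 1) := by rw [← pow_mul]; congr 1
    _ < (ε ^ 2 * ((m : ℝ) + 1)) ^ (m + 1) := pow_lt_pow_left₀ hL2 (sq_nonneg _) (by omega)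
    _ = (ε ^ 2) ^ (m + 1) * ((m : ℝ) + 1) ^ (m + 1) := mul_pow _ _ _
    _ ≤ ε * (2 * m + 1 + 1).factorial := by
      refine mul_le_mul ?_ hfac (by positivity) hε.le
      rw [← pow_mul]
      exact pow_le_of_le_one hε.le hε1 (by omega)

/-! ### Expectations of truncated products and of agreement indicators -/

/-- The expectation of a truncated product is determined, up to the accumulated error, by the
expectations of the monomials. -/
lemma abs_expect_mul_truncatedProd_sub_le {α ι : Type*} (B : Finset α) (s : Finset ι) (k : ℕ)
    (w : α → ℝ) (x : ι → α → ℝ) (v : ℝ) (p : ι → ℝ) (β : ℝ)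
    (h : ∀ m < k, ∀ J ∈ s.powersetCard m,
      |(𝔼 a ∈ B, w a * ∏ i ∈ J, x i a) - v * ∏ i ∈ J, p i| ≤ β) :
    |(𝔼 a ∈ B, w a * truncatedProd k s (fun i => x i a)) - v * truncatedProd k s p| ≤
      β * ∑ m ∈ Finset.range k, (s.card.choose m : ℝ) := by
  have e : (𝔼 a ∈ B, w a * truncatedProd k s (fun i => x i a)) - v * truncatedProd k s p =
      ∑ m ∈ Finset.range k, ∑ J ∈ s.powersetCard m,
        (-1) ^ m * ((𝔼 a ∈ B, w a * ∏ i ∈ J, x i a) - v * ∏ i ∈ J, p i) := by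
    have e1 : (𝔼 a ∈ B, w a * truncatedProd k s (fun i => x i a)) =
        ∑ m ∈ Finset.range k, ∑ J ∈ s.powersetCard m,
          (-1) ^ m * 𝔼 a ∈ B, w a * ∏ i ∈ J, x i a := by
      simp only [truncatedProd, Finset.mul_sum, Finset.expect_sum_comm, Finset.mul_expect]
      refine Finset.sum_congr rfl fun m _ => Finset.sum_congr rfl fun J _ =>
        Finset.expect_congr rfl fun a _ => by ring
    rw [e1]
    simp only [truncatedProd, Finset.mul_sum, ← Finset.sum_sub_distrib]
    refine Finset.sum_congr rfl fun m _ => Finset.sum_congr rfl fun J _ => by ring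
  rw [e, Finset.mul_sum]
  refine (Finset.abs_sum_le_sum_abs _ _).trans (Finset.sum_le_sum fun m hm => ?_)
  refine (Finset.abs_sum_le_sum_abs _ _).trans ?_
  rw [← Finset.card_powersetCard, mul_comm, ← nsmul_eq_mul]
  refine Finset.sum_le_card_nsmul _ _ _ fun J hJ => ?_
  rw [abs_mul, abs_pow, abs_neg, abs_one, one_pow, one_mul]
  exact h m (Finset.mem_range.1 hm) J hJ

/-- The indicator function of agreement with `c` on `S`. -/
noncomputable def agreeInd {n : ℕ} (c : Fin n → Bool) (S : Finset (Fin n)) (a : Fin n → Bool) : ℝ :=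
  if ∀ i ∈ S, a i = c i then 1 else 0

section agreeInd

variable {n : ℕ} (c : Fin n → Bool)

lemma agreeInd_nonneg (S : Finset (Fin n)) (a : Fin n → Bool) : 0 ≤ agreeInd c S a := by
  unfold agreeInd; split_ifs <;> norm_num

lemma agreeInd_le_one (S : Finset (Fin n)) (a : Fin n → Bool) : agreeInd c S a ≤ 1 := by
  unfold agreeInd; split_ifs <;> norm_num

lemma agreeInd_mul_prod {ι : Type*} (Q : Finset (Fin n)) (J : Finset ι) (R : ι → Finset (Fin n))
    (a : Fin n → Bool) :
    agreeInd c Q a * ∏ j ∈ J, agreeInd c (R j) a = agreeInd c (Q ∪ J.biUnion R) a := by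
  unfold agreeInd
  rw [Finset.prod_ite_zero, Finset.prod_const_one, ite_zero_mul_ite_zero, one_mul]
  refine if_congr ?_ rfl rfl
  simp only [Finset.mem_union, Finset.mem_biUnion]
  constructor
  · rintro ⟨h1, h2⟩ i (hi | ⟨j, hj, hi⟩)
    exacts [h1 i hi, h2 j hj i hi]
  · exact fun h => ⟨fun i hi => h i (.inl hi), fun j hj i hi => h i (.inr ⟨j, hj, hi⟩)⟩

lemma agreeInd_eq_zero_iff (S : Finset (Fin n)) (a : Fin n → Bool) :
    agreeInd c S a = 0 ↔ ∃ i ∈ S, a i ≠ c i := by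
  simp [agreeInd]

lemma one_div_two_pow_mul_prod {ι : Type*} (Q : Finset (Fin n)) (J : Finset ι)
    (R : ι → Finset (Fin n)) (hR : (J : Set ι).PairwiseDisjoint R)
    (hQ : ∀ j ∈ J, Disjoint Q (R j)) :
    1 / (2 : ℝ) ^ Q.card * ∏ j ∈ J, 1 / (2 : ℝ) ^ (R j).card =
      1 / 2 ^ (Q ∪ J.biUnion R).card := by
  rw [Finset.card_union_of_disjoint ((Finset.disjoint_biUnion_right _ _ _).2 hQ),
    Finset.card_biUnion hR, pow_add, ← Finset.prod_pow_eq_pow_sum, Finset.prod_div_distrib,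
    Finset.prod_const_one, div_mul_div_comm, one_mul]

lemma expect_agreeInd (S : Finset (Fin n)) :
    𝔼 a : Fin n → Bool, agreeInd c S a = 1 / 2 ^ S.card := by
  classical
  have hcard : (Finset.univ.filter fun a : Fin n → Bool => ∀ i ∈ S, a i = c i).card =
      2 ^ (n - S.card) := by
    have : (Finset.univ.filter fun a : Fin n → Bool => ∀ i ∈ S, a i = c i) =
        Fintype.piFinset fun i => if i ∈ S then {c i} else Finset.univ := by
      ext a
      simp only [Finset.mem_filter, Finset.mem_univ, true_and, Fintype.mem_piFinset]
      refine forall_congr' fun i => ?_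
      split_ifs with hi <;> simp [hi]
    rw [this, Fintype.card_piFinset]
    simp only [apply_ite Finset.card, Finset.card_singleton, Finset.card_univ, Fintype.card_bool]
    rw [Finset.prod_ite, Finset.prod_const_one, Finset.prod_const, one_mul]
    congr 1
    rw [Finset.filter_not, Finset.card_sdiff]
    simp
  have hle : S.card ≤ n := by simpa using S.card_le_univ
  rw [Finset.expect_eq_sum_div_card]
  unfold agreeInd
  rw [Finset.sum_boole, hcard, Finset.card_univ, Fintype.card_fun, Fintype.card_bool,
    Fintype.card_fin, div_eq_div_iff (by positivity) (by positivity)]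
  push_cast
  rw [one_mul, ← pow_add, Nat.sub_add_cancel hle]

/-- The indicator of a read-once CNF has expectation at most (in fact, exactly) the product of
those of its clauses. -/
lemma expect_prod_one_sub_agreeInd_le {r : ℕ} (R : Fin r → Finset (Fin n))
    (hR : ∀ j j', j ≠ j' → Disjoint (R j) (R j')) :
    𝔼 a : Fin n → Bool, ∏ j, (1 - agreeInd c (R j) a) ≤
      ∏ j, (1 - 1 / (2 : ℝ) ^ (R j).card) := by
  -- An even number exceeding `r`: the expansion is not truncated at all, and under the uniform
  -- distribution the monomials have error `0`.
  have hk : Even (2 * (r + 1)) := even_two_mul _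
  have h1 : ∀ a : Fin n → Bool, ∏ j, (1 - agreeInd c (R j) a) ≤
      agreeInd c ∅ a * truncatedProd (2 * (r + 1)) Finset.univ fun j => agreeInd c (R j) a := by
    intro a
    have := prod_le_truncatedProd_add Finset.univ (fun j => agreeInd c (R j) a)
      (fun j _ => agreeInd_nonneg c _ a) (fun j _ => agreeInd_le_one c _ a) hk
    rw [Finset.powersetCard_eq_empty.2 (by simp; omega), Finset.sum_empty, add_zero] at this
    simpa [agreeInd] using this
  have h2 := abs_expect_mul_truncatedProd_sub_le Finset.univ (Finset.univ : Finset (Fin r))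
    (2 * (r + 1)) (agreeInd c ∅) (fun j => agreeInd c (R j)) 1
    (fun j => 1 / (2 : ℝ) ^ (R j).card) 0 (fun m _ J _ => by
      simp only [agreeInd_mul_prod]
      rw [expect_agreeInd, ← one_div_two_pow_mul_prod _ _ _ (fun j _ j' _ h => hR j j' h) (by simp)]
      simp)
  rw [zero_mul, abs_nonpos_iff, sub_eq_zero, one_mul] at h2
  refine (Finset.expect_le_expect fun a _ => h1 a).trans (h2.le.trans ?_)
  exact truncatedProd_le_prod _ _ (fun j _ => by positivity)
    (fun j _ => div_le_one_of_le₀ (one_le_pow₀ one_le_two) (by positivity)) hk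

end agreeInd

/-! ### Richness -/

/-- Small clauses are handled by the Bonferroni inequalities, large ones by the union bound. -/
lemma exists_agree_and_disagree {n : ℕ} (B : Finset (Fin n → Bool)) (c : Fin n → Bool)
    {K k l : ℕ} {β : ℝ}
    (hB : ∀ S : Finset (Fin n), S.card ≤ K →
      |(𝔼 a ∈ B, agreeInd c S a) - 1 / 2 ^ S.card| ≤ β)
    (Q : Finset (Fin n)) (hQ : Q.card ≤ l) (hk : Even k) (hK : k * l ≤ K) (hK' : 2 * l + 1 ≤ K)
    (s t : Finset (Finset (Fin n))) (hs : ∀ R ∈ s, R.card ≤ l)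
    (hsd : (s : Set (Finset (Fin n))).PairwiseDisjoint id)
    (hQs : ∀ R ∈ s, Disjoint Q R) (hQt : ∀ R ∈ t, Disjoint Q R) (ht : ∀ R ∈ t, l < R.card)
    (hpos : β * ((∑ m ∈ Finset.range k, (s.card.choose m : ℝ)) + t.card) <
      1 / 2 ^ Q.card *
        (truncatedProd k s (fun R => 1 / (2 : ℝ) ^ R.card) - t.card * (1 / 2 ^ (l + 1)))) :
    ∃ a ∈ B, (∀ i ∈ Q, a i = c i) ∧ ∀ R ∈ s ∪ t, ∃ i ∈ R, a i ≠ c i := by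
  classical
  -- A long clause is shrunk to `l + 1` positions, so that together with `Q` it stays within `2l + 1
  -- ≤ K`; disagreement on the subset suffices.
  have hsub : ∀ R : Finset (Fin n), ∃ R' ⊆ R, l < R.card → R'.card = l + 1 := by
    intro R
    by_cases h : l < R.card
    · obtain ⟨R', h1, h2⟩ := Finset.exists_subset_card_eq (Nat.succ_le_of_lt h)
      exact ⟨R', h1, fun _ => h2⟩
    · exact ⟨R, subset_rfl, fun h' => absurd h' h⟩
  choose f hfR hfcard using hsub
  have hsmall := abs_expect_mul_truncatedProd_sub_le B s k (agreeInd c Q) (agreeInd c)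
    (1 / 2 ^ Q.card) (fun R => 1 / (2 : ℝ) ^ R.card) β (fun m hm J hJ => by
      obtain ⟨hJs, hJm⟩ := Finset.mem_powersetCard.1 hJ
      have hd : (J : Set (Finset (Fin n))).PairwiseDisjoint id := hsd.subset (by exact_mod_cast hJs)
      have hcard : (Q ∪ J.biUnion id).card ≤ K := by
        refine (Finset.card_union_le _ _).trans ?_
        have h1 : (J.biUnion id).card ≤ J.card * l :=
          Finset.card_biUnion_le_card_mul _ _ _ fun R hR => hs R (hJs hR)
        calc Q.card + (J.biUnion id).card ≤ l + m * l := add_le_add hQ (hJm ▸ h1)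
          _ = (m + 1) * l := by ring
          _ ≤ k * l := Nat.mul_le_mul_right _ hm
          _ ≤ K := hK
      have e1 : ∀ a, agreeInd c Q a * ∏ R ∈ J, agreeInd c R a = agreeInd c (Q ∪ J.biUnion id) a :=
        fun a => agreeInd_mul_prod c Q J id a
      have e2 := one_div_two_pow_mul_prod Q J id hd fun R hR => hQs R (hJs hR)
      simp only [id] at e2
      simp only [e1, e2]
      exact hB _ hcard)
  have hlarge : ∀ R ∈ t, (𝔼 a ∈ B, agreeInd c Q a * agreeInd c (f R) a) ≤
      1 / 2 ^ Q.card * (1 / 2 ^ (l + 1)) + β := by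
    intro R hR
    have e1 : ∀ a, agreeInd c Q a * agreeInd c (f R) a = agreeInd c (Q ∪ f R) a := fun a => by
      simpa using agreeInd_mul_prod c Q {f R} id a
    have hcard : (Q ∪ f R).card = Q.card + (l + 1) := by
      rw [Finset.card_union_of_disjoint ((hQt R hR).mono_right (hfR R)), hfcard R (ht R hR)]
    have := (abs_le.1 (hB (Q ∪ f R) (by omega))).2
    simp only [e1]
    rw [hcard, pow_add, ← one_div_mul_one_div] at this
    linarith
  -- Where this integrand is positive, `a` agrees with `c` on `Q`, and a sum of 0-1 indicators lies
  -- strictly below a product that is at most `1`. Hence the sum vanishes and the product does not.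
  have havg : 0 < 𝔼 a ∈ B, agreeInd c Q a *
      (∏ R ∈ s, (1 - agreeInd c R a) - ∑ R ∈ t, agreeInd c (f R) a) := by
    have h1 : (𝔼 a ∈ B, agreeInd c Q a * truncatedProd k s (fun R => agreeInd c R a)) ≤
        𝔼 a ∈ B, agreeInd c Q a * ∏ R ∈ s, (1 - agreeInd c R a) :=
      Finset.expect_le_expect fun a _ => mul_le_mul_of_nonneg_left
        (truncatedProd_le_prod _ _ (fun R _ => agreeInd_nonneg c R a)
          (fun R _ => agreeInd_le_one c R a) hk) (agreeInd_nonneg c Q a)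
    have h2 := Finset.sum_le_card_nsmul t _ _ hlarge
    simp only [mul_sub, Finset.expect_sub_distrib, Finset.mul_sum, Finset.expect_sum_comm]
    rw [nsmul_eq_mul] at h2
    have h3 := (abs_le.1 hsmall).1
    linarith
  obtain ⟨a, haB, ha⟩ : ∃ a ∈ B, 0 < agreeInd c Q a *
      (∏ R ∈ s, (1 - agreeInd c R a) - ∑ R ∈ t, agreeInd c (f R) a) := by
    by_contra! h
    exact havg.not_ge ((Finset.expect_le_expect h).trans_eq (Finset.expect_const_zero B))
  have hQa : ∀ i ∈ Q, a i = c i := by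
    by_contra! h
    rw [(agreeInd_eq_zero_iff c Q a).2 h, zero_mul] at ha
    exact lt_irrefl _ ha
  have hsum : ∑ R ∈ t, agreeInd c (f R) a < ∏ R ∈ s, (1 - agreeInd c R a) := by
    rw [agreeInd, if_pos hQa, one_mul] at ha
    linarith
  have hsum0 : 0 ≤ ∑ R ∈ t, agreeInd c (f R) a :=
    Finset.sum_nonneg fun R _ => agreeInd_nonneg c _ a
  refine ⟨a, haB, hQa, fun R hR => ?_⟩
  rcases Finset.mem_union.1 hR with hR | hR
  · by_contra! h
    rw [Finset.prod_eq_zero hR (by rw [agreeInd, if_pos h, sub_self])] at hsum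
    linarith
  · obtain ⟨i, hi, h⟩ : ∃ i ∈ f R, a i ≠ c i := by
      by_contra! h
      have h1 := Finset.single_le_sum (f := fun R => agreeInd c (f R) a)
        (fun R _ => agreeInd_nonneg c _ a) hR
      have h2 : ∏ R ∈ s, (1 - agreeInd c R a) ≤ 1 := Finset.prod_le_one
        (fun R _ => sub_nonneg.2 (agreeInd_le_one c R a))
        fun R _ => sub_le_self _ (agreeInd_nonneg c R a)
      rw [agreeInd, if_pos h] at h1
      linarith
    exact ⟨i, hfR R hi, h⟩

lemma card_filter_mul_le_of_finpartition {n : ℕ} {I : Finset (Fin n)} (P : Finpartition I) (l : ℕ) :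
    (P.parts.filter fun R => l < R.card).card * (l + 1) ≤ n := by
  calc (P.parts.filter fun R => l < R.card).card * (l + 1)
      ≤ ∑ R ∈ P.parts.filter fun R => l < R.card, R.card := by
        rw [← smul_eq_mul]
        exact Finset.card_nsmul_le_sum _ _ _ fun R hR => (Finset.mem_filter.1 hR).2
    _ ≤ ∑ R ∈ P.parts, R.card := Finset.sum_le_sum_of_subset (Finset.filter_subset _ _)
    _ = I.card := P.sum_card_parts
    _ ≤ n := by simpa using I.card_le_univ

/-- Richness at a fixed length, with `hlog` and `hn2` saying that `n` is large. Of the gap `δ`, one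
half pays for the long clauses and the other absorbs the error from `β`. -/
lemma exists_of_finpartition {n C : ℕ} {ε β : ℝ} (hε : 0 < ε) (hC : Odd C)
    (B : Finset (Fin n → Bool)) (c : Fin n → Bool) {K : ℕ}
    (hB : ∀ S : Finset (Fin n), S.card ≤ K →
      |(𝔼 a ∈ B, agreeInd c S a) - 1 / 2 ^ S.card| ≤ β)
    (hK : (C + 2) * Nat.log 2 n ≤ K) (hβ : β < 1 / (n : ℝ) ^ (C + 3)) (hn : 2 ≤ n) {δ : ℝ}
    (hδ : δ * (C + 1).factorial ≤ ε * (C + 1).factorial - Real.log (1 / ε) ^ (C + 1))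
    (hlog : 1 / ((Nat.log 2 n : ℝ) + 1) ≤ δ / 2) (hn2 : ((C : ℝ) + 2) ≤ δ / 2 * n)
    {I : Finset (Fin n)} (P : Finpartition I)
    (hP : ε ≤ ∏ R ∈ P.parts, (1 - 1 / (2 : ℝ) ^ R.card))
    (Q : Finset (Fin n)) (hQI : Disjoint Q I) (hQ : Q.card ≤ Nat.log 2 n) :
    ∃ a ∈ B, (∀ i ∈ Q, a i = c i) ∧ ∀ R ∈ P.parts, ∃ i ∈ R, a i ≠ c i := by
  classical
  set l := Nat.log 2 n with hl
  have hl1 : 1 ≤ l := Nat.log_pos one_lt_two hn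
  have hC1 : 1 ≤ C := hC.pos
  have hn0 : (0 : ℝ) < n := by positivity
  have hn1 : (1 : ℝ) ≤ n := by exact_mod_cast (by omega : 1 ≤ n)
  set s := P.parts.filter fun R => ¬ l < R.card with hs
  set t := P.parts.filter fun R => l < R.card with ht
  have hst : P.parts = s ∪ t := by rw [hs, ht, Finset.union_comm, Finset.filter_union_filter_not_eq]
  have hQR : ∀ R ∈ P.parts, Disjoint Q R := fun R hR => hQI.mono_right (P.le hR)
  set p : Finset (Fin n) → ℝ := fun R => 1 / (2 : ℝ) ^ R.card with hp
  have hp0 : ∀ R, 0 ≤ p R := fun R => by positivity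
  have hp1 : ∀ R, p R ≤ 1 := fun R =>
    div_le_one_of_le₀ (one_le_pow₀ one_le_two) (by positivity)
  have hprod : ε ≤ ∏ R ∈ s, (1 - p R) := by
    refine hP.trans ?_
    rw [hst, Finset.prod_union (Finset.disjoint_filter_filter_not _ _ _).symm]
    exact mul_le_of_le_one_right (Finset.prod_nonneg fun R _ => sub_nonneg.2 (hp1 R))
      (Finset.prod_le_one (fun R _ => sub_nonneg.2 (hp1 R)) fun R _ => sub_le_self _ (hp0 R))
  have htrunc : δ ≤ truncatedProd (C + 1) s p := by
    have h1 := prod_le_truncatedProd_add s p (fun R _ => hp0 R) (fun R _ => hp1 R) hC.add_one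
    have h2 := factorial_mul_sum_powersetCard_le s p (fun R _ => hp0 R) (C + 1)
    have h3 := pow_le_pow_left₀ (Finset.sum_nonneg fun R _ => hp0 R)
      (sum_le_log_one_div_of_le_prod s p hε (fun R _ => hp1 R) hprod) (C + 1)
    have hf : (0 : ℝ) < (C + 1).factorial := by positivity
    have h4 := mul_le_mul_of_nonneg_right (hprod.trans h1) hf.le
    refine le_of_mul_le_mul_right ?_ hf
    linarith
  have ht1 : (t.card : ℝ) * (1 / 2 ^ (l + 1)) ≤ δ / 2 := by
    refine le_trans ?_ hlog
    have h1 : (t.card : ℝ) * ((l : ℝ) + 1) ≤ n := by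
      exact_mod_cast card_filter_mul_le_of_finpartition P l
    have h2 : (n : ℝ) ≤ 2 ^ (l + 1) := by
      exact_mod_cast (Nat.lt_pow_succ_log_self one_lt_two n).le
    rw [mul_one_div, div_le_div_iff₀ (by positivity) (by positivity), one_mul]
    exact h1.trans h2
  have hparts : P.parts.card ≤ n := P.card_parts_le_card.trans (by simpa using I.card_le_univ)
  have hs_card : (s.card : ℝ) ≤ n := by
    exact_mod_cast (Finset.card_filter_le _ _).trans hparts
  have ht_card : (t.card : ℝ) ≤ n := by
    exact_mod_cast (Finset.card_filter_le _ _).trans hparts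
  have hcount : (∑ m ∈ Finset.range (C + 1), (s.card.choose m : ℝ)) + t.card ≤
      ((C : ℝ) + 2) * n ^ C := by
    have h1 : ∀ m ∈ Finset.range (C + 1), (s.card.choose m : ℝ) ≤ (n : ℝ) ^ C := by
      intro m hm
      calc (s.card.choose m : ℝ) ≤ (s.card : ℝ) ^ m := by
            rw [← Nat.cast_pow]
            exact Nat.cast_le.2 (Nat.choose_le_pow _ _)
        _ ≤ (n : ℝ) ^ m := pow_le_pow_left₀ (Nat.cast_nonneg _) hs_card m
        _ ≤ (n : ℝ) ^ C := pow_le_pow_right₀ hn1 (Nat.lt_succ_iff.1 (Finset.mem_range.1 hm))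
    have h2 := Finset.sum_le_card_nsmul _ _ _ h1
    rw [Finset.card_range, nsmul_eq_mul] at h2
    push_cast at h2
    have h3 : (n : ℝ) ≤ n ^ C := le_self_pow₀ hn1 (by omega)
    linarith
  have hδ0 : 0 < δ := by
    have : 0 < 1 / ((l : ℝ) + 1) := by positivity
    linarith
  have hQpow : 1 / (n : ℝ) ≤ 1 / 2 ^ Q.card := by
    refine one_div_le_one_div_of_le (by positivity) ?_
    exact_mod_cast (Nat.pow_le_pow_right two_pos hQ).trans (Nat.pow_log_le_self 2 (by omega))
  have hβ0 : 0 ≤ β := (abs_nonneg _).trans (hB ∅ (by simp))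
  rw [hst]
  refine exists_agree_and_disagree B c hB Q hQ hC.add_one
    ((Nat.mul_le_mul_right _ (by omega)).trans hK) (le_trans ?_ hK) s t
    (fun R hR => not_lt.1 (Finset.mem_filter.1 hR).2)
    (P.disjoint.subset (by exact_mod_cast Finset.filter_subset _ _))
    (fun R hR => hQR R (Finset.filter_subset _ _ hR))
    (fun R hR => hQR R (Finset.filter_subset _ _ hR)) (fun R hR => (Finset.mem_filter.1 hR).2) ?_
  -- `2l + 1 ≤ 3l ≤ (C + 2) l`.
  · nlinarith [Nat.mul_le_mul hC1 hl1, Nat.mul_le_mul_right l hC1]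
  -- Of the factor `n^(C+3)`, `n^C` pays for the number of monomials, one `n` for `2^{-|Q|} ≥ 1/n`,
  -- one for the constant `C + 2`, and one is to spare.
  · calc β * ((∑ m ∈ Finset.range (C + 1), (s.card.choose m : ℝ)) + t.card)
        ≤ β * (((C : ℝ) + 2) * n ^ C) := mul_le_mul_of_nonneg_left hcount hβ0
      _ < 1 / (n : ℝ) ^ (C + 3) * (((C : ℝ) + 2) * n ^ C) :=
        mul_lt_mul_of_pos_right hβ (by positivity)
      _ = ((C : ℝ) + 2) / n ^ 3 := by rw [pow_add]; field_simp
      _ ≤ (δ / 2 * n) / n ^ 3 := by gcongr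
      _ = 1 / n * (1 / n) * (δ / 2) := by field_simp
      _ ≤ 1 / n * 1 * (δ / 2) := by
        gcongr
        exact div_le_one_of_le₀ hn1 hn0.le
      _ = 1 / n * (δ / 2) := by ring
      _ ≤ 1 / 2 ^ Q.card * (δ / 2) := by gcongr
      _ ≤ 1 / 2 ^ Q.card *
          (truncatedProd (C + 1) s p - t.card * (1 / 2 ^ (l + 1))) := by
        gcongr
        linarith

lemma expect_agreeInd_slice (A : Set (List Bool)) {n : ℕ} (S : Finset (Fin n)) (c : Fin n → Bool) :
    (𝔼 a ∈ (Set.toFinite (slice A n)).toFinset, agreeInd c S a) =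
      ((agreeing A S c).ncard : ℝ) / ((slice A n).ncard : ℝ) := by
  classical
  rw [Finset.expect_eq_sum_div_card, ← Set.ncard_eq_toFinset_card]
  congr 1
  unfold agreeInd
  rw [Finset.sum_boole, ← Set.ncard_coe_finset]
  congr 2
  ext a
  simp [agreeing]

lemma natCast_le_logb_iff {m n : ℕ} (hn : n ≠ 0) : (m : ℝ) ≤ Real.logb 2 n ↔ m ≤ Nat.log 2 n := by
  rw [Nat.le_log_iff_pow_le one_lt_two hn, Real.le_logb_iff_rpow_le one_lt_two (by positivity),
    Real.rpow_natCast]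
  exact_mod_cast Iff.rfl

lemma eventually_one_div_log_add_one_lt {δ : ℝ} (hδ : 0 < δ) :
    ∀ᶠ n : ℕ in atTop, 1 / ((Nat.log 2 n : ℝ) + 1) < δ := by
  obtain ⟨M, hM⟩ := exists_nat_one_div_lt hδ
  filter_upwards [eventually_ge_atTop (2 ^ M)] with n hn
  refine lt_of_le_of_lt ?_ hM
  have : M ≤ Nat.log 2 n := Nat.le_log_of_pow_le one_lt_two hn
  gcongr

theorem isRich_of_isAlmostWiseIndependent {ε : ℝ} (hε : 0 < ε) {C : ℕ} (hodd : Odd C)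
    (hC : (2 / ε * Real.log (1 / ε)) ^ 2 < (C : ℝ)) {β : ℕ → ℝ}
    (hβ : ∀ᶠ n : ℕ in atTop, β n < 1 / (n : ℝ) ^ (C + 3)) {A : Set (List Bool)}
    (hA : IsAlmostWiseIndependent (fun n => ⌈((C : ℝ) + 2) * Real.logb 2 (n : ℝ)⌉₊) β A) :
    IsRich ε A := by
  by_cases hε1 : ε ≤ 1
  · obtain ⟨δ, hδ⟩ : ∃ δ, δ = ε - Real.log (1 / ε) ^ (C + 1) / (C + 1).factorial := ⟨_, rfl⟩
    have hf : (0 : ℝ) < (C + 1).factorial := by positivity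
    have hδ0 : 0 < δ := by
      rw [hδ, sub_pos, div_lt_iff₀ hf]
      exact log_pow_lt_mul_factorial hε hε1 hodd hC
    have hδ1 : δ * (C + 1).factorial ≤ ε * (C + 1).factorial - Real.log (1 / ε) ^ (C + 1) := by
      rw [hδ, sub_mul, div_mul_cancel₀ _ hf.ne']
    filter_upwards [hA, hβ, eventually_ge_atTop 2, eventually_one_div_log_add_one_lt (half_pos hδ0),
      (tendsto_natCast_atTop_atTop.const_mul_atTop (half_pos hδ0)).eventually_ge_atTop
        ((C : ℝ) + 2)] with n hAn hβn hn hlog hn2 I P hP Q hQI hQ c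
    have hK : (C + 2) * Nat.log 2 n ≤ ⌈((C : ℝ) + 2) * Real.logb 2 (n : ℝ)⌉₊ := by
      have h1 : (Nat.log 2 n : ℝ) ≤ Real.logb 2 n := (natCast_le_logb_iff (by omega)).2 le_rfl
      have h2 : ((C : ℝ) + 2) * Nat.log 2 n ≤ _ :=
        (mul_le_mul_of_nonneg_left h1 (by positivity)).trans (Nat.le_ceil _)
      exact_mod_cast h2
    obtain ⟨a, ha, h⟩ := exists_of_finpartition hε hodd (Set.toFinite (slice A n)).toFinset c
      (fun S hS => by rw [expect_agreeInd_slice]; exact hAn.2 S hS c) hK hβn hn hδ1 hlog.le hn2 P hP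
      Q hQI ((natCast_le_logb_iff (by omega)).1 hQ)
    exact ⟨a, by simpa using ha, h⟩
  -- For `ε > 1` no partition meets the product condition.
  · refine Eventually.of_forall fun n I P hP => absurd (hP.trans ?_) hε1
    exact Finset.prod_le_one (fun R _ => sub_nonneg.2
      (div_le_one_of_le₀ (one_le_pow₀ one_le_two) (by positivity)))
      fun R _ => sub_le_self _ (by positivity)

/-! ### Hitting sets -/

/-- A read-once DNF all of whose terms have more than `log n` literals accepts few inputs. -/
lemma exists_card_le_log_of_le_expect {n q : ℕ} (c : Fin n → Bool) (Q : Fin q → Finset (Fin n))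
    (hQ : ∀ j j', j ≠ j' → Disjoint (Q j) (Q j'))
    (h : 1 / ((Nat.log 2 n : ℝ) + 1) < 𝔼 a : Fin n → Bool, ∑ j, agreeInd c (Q j) a) :
    ∃ j, (Q j).card ≤ Nat.log 2 n := by
  by_contra! hlt
  set l := Nat.log 2 n
  have h1 : q * (l + 1) ≤ n := by
    calc q * (l + 1) = (Finset.univ : Finset (Fin q)).card • (l + 1) := by simp
      _ ≤ ∑ j, (Q j).card := Finset.card_nsmul_le_sum _ _ _ fun j _ => hlt j
      _ = (Finset.univ.biUnion Q).card := (Finset.card_biUnion fun j _ j' _ h => hQ j j' h).symm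
      _ ≤ n := by simpa using (Finset.univ.biUnion Q).card_le_univ
  have h2 : (n : ℝ) ≤ 2 ^ (l + 1) := by
    exact_mod_cast (Nat.lt_pow_succ_log_self one_lt_two n).le
  refine h.not_ge ?_
  simp only [Finset.expect_sum_comm, expect_agreeInd]
  calc ∑ j, 1 / (2 : ℝ) ^ (Q j).card ≤ ∑ _j : Fin q, 1 / (2 : ℝ) ^ (l + 1) := by
        refine Finset.sum_le_sum fun j _ => ?_
        exact one_div_le_one_div_of_le (by positivity) (pow_le_pow_right₀ one_le_two (hlt j))
    _ = (q : ℝ) * (1 / 2 ^ (l + 1)) := by simp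
    _ ≤ 1 / ((l : ℝ) + 1) := by
      rw [mul_one_div, div_le_div_iff₀ (by positivity) (by positivity), one_mul]
      exact le_trans (by exact_mod_cast h1) h2

theorem IsRich.isHittingSetForReadOnceDNFCNF {ε : ℝ} (hε : 0 < ε) {A : Set (List Bool)}
    (hA : IsRich ε A) : IsHittingSetForReadOnceDNFCNF ε A := by
  classical
  filter_upwards [hA, eventually_ge_atTop 1, eventually_one_div_log_add_one_lt hε]
    with n hrich hn hlog F hF
  have hacc : ({a | F.Accepts a}.ncard : ℝ) / 2 ^ n =
      𝔼 a : Fin n → Bool, if F.Accepts a then (1 : ℝ) else 0 := by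
    rw [Finset.expect_eq_sum_div_card, Finset.sum_boole, Set.ncard_eq_toFinset_card']
    simp
  rw [hacc] at hF
  have hprod : ε ≤ ∏ j, (1 - 1 / (2 : ℝ) ^ (F.R j).card) := by
    refine hF.trans (le_trans (Finset.expect_le_expect fun a _ => ?_)
      (expect_prod_one_sub_agreeInd_le F.c F.R F.disjoint_RR))
    split_ifs with h
    · refine le_of_eq (Finset.prod_eq_one fun j _ => ?_).symm
      rw [(agreeInd_eq_zero_iff F.c _ a).2 (h.2 j), sub_zero]
    · exact Finset.prod_nonneg fun j _ => sub_nonneg.2 (agreeInd_le_one _ _ _)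
  -- An empty clause would contribute a factor `0`. Nonempty disjoint clauses are distinct, so
  -- passing from the family to its set of parts loses no factor.
  have hne : ∀ j, (F.R j).Nonempty := by
    intro j
    by_contra hj
    rw [Finset.not_nonempty_iff_eq_empty] at hj
    rw [Finset.prod_eq_zero (Finset.mem_univ j) (by simp [hj])] at hprod
    linarith
  have hinj : Function.Injective F.R := by
    intro j j' h
    by_contra hjj
    have := F.disjoint_RR j j' hjj
    rw [← h, disjoint_self] at this
    exact (hne j).ne_empty this
  let P : Finpartition (Finset.univ.biUnion F.R) :=
    { parts := Finset.univ.image F.R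
      supIndep := by
        rw [Finset.supIndep_iff_pairwiseDisjoint]
        intro R hR R' hR' h
        simp only [Finset.coe_image, Finset.coe_univ, Set.image_univ, Set.mem_range] at hR hR'
        obtain ⟨j, rfl⟩ := hR
        obtain ⟨j', rfl⟩ := hR'
        exact F.disjoint_RR j j' fun e => h (by rw [e])
      sup_parts := by rw [Finset.sup_image, Finset.sup_eq_biUnion]; rfl
      bot_notMem := by
        simp only [Finset.mem_image, Finset.mem_univ, true_and, not_exists]
        exact fun j => (hne j).ne_empty }
  have hP : ε ≤ ∏ R ∈ P.parts, (1 - 1 / (2 : ℝ) ^ R.card) := by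
    change ε ≤ ∏ R ∈ Finset.univ.image F.R, (1 - 1 / (2 : ℝ) ^ R.card)
    rwa [Finset.prod_image fun j _ j' _ h => hinj h]
  have hclause : ∀ j, F.R j ∈ P.parts := fun j =>
    Finset.mem_image_of_mem _ (Finset.mem_univ j)
  by_cases hq : F.q = 0
  · obtain ⟨a, ha, -, h⟩ := hrich _ P hP ∅ (by simp)
      ((natCast_le_logb_iff (by omega)).2 (by simp)) F.c
    exact ⟨a, ha, .inl hq, fun j => h _ (hclause j)⟩
  · obtain ⟨j₀, hj₀⟩ := exists_card_le_log_of_le_expect F.c F.Q F.disjoint_QQ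
      (hlog.trans_le (hF.trans (Finset.expect_le_expect fun a _ => by
        have h0 : ∀ j ∈ Finset.univ, 0 ≤ agreeInd F.c (F.Q j) a := fun j _ => agreeInd_nonneg _ _ _
        split_ifs with h
        · obtain ⟨j, hj⟩ := h.1.resolve_left hq
          refine le_trans ?_ (Finset.single_le_sum h0 (Finset.mem_univ j))
          rw [agreeInd, if_pos hj]
        · exact Finset.sum_nonneg h0)))
    obtain ⟨a, ha, hQ, h⟩ := hrich _ P hP (F.Q j₀)
      ((Finset.disjoint_biUnion_right _ _ _).2 fun j _ => F.disjoint_QR j₀ j)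
      ((natCast_le_logb_iff (by omega)).2 hj₀) F.c
    exact ⟨a, ha, .inr ⟨j₀, hQ⟩, fun j => h _ (hclause j)⟩

end Richness

theorem theorem2 (ε : ℝ) (hε : 0 < ε) (C : ℕ)
    (hC : IsLeast {m : ℕ | Odd m ∧ (2 / ε * Real.log (1 / ε)) ^ 2 < (m : ℝ)} C)
    (β : ℕ → ℝ) (hβ : ∀ᶠ n : ℕ in Filter.atTop, 0 < β n ∧ β n < 1 / (n : ℝ) ^ (C + 3))
    (A : Set (List Bool))
    (hA : Richness.IsAlmostWiseIndependent
      (fun n => ⌈((C : ℝ) + 2) * Real.logb 2 (n : ℝ)⌉₊) β A) :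
    Richness.IsRich ε A ∧ Richness.IsHittingSetForReadOnceDNFCNF ε A := by
  have h := Richness.isRich_of_isAlmostWiseIndependent hε hC.1.1 hC.1.2
    (hβ.mono fun n hn => hn.2) hA
  exact ⟨h, h.isHittingSetForReadOnceDNFCNF hε⟩
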